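/- Let $K$ be an arbitrary field with $|K|\ge 4$, let $W$ be a six-dimensional vector space over $K$, and let $\mathrm{Symm}(W)$ be the space of symmetric bilinear forms $f:W\times W\to K$. The radical of $f\in\mathrm{Symm}(W)$ is $\operatorname{rad} f=\{u\in W: f(u,v)=0 \text{ for all } v\in W\}$ and its rank is $\dim W-\dim\operatorname{rad} f$. A constant rank $r$ subspace is a non-zero subspace of $\mathrm{Symm}(W)$ all of whose non-zero elements have rank $r$. Let $\mathcal M$ be a subspace of $\mathrm{Symm}(W)$ in which each non-zero element has rank $3$ or $6$, and for $u\in W$ put $\mathcal M_u=\{f\in\mathcal M: u\in\operatorname{rad} f\}$. Then $\dim\mathcal M\le 9$. Furthermore, suppose that $\dim\mathcal M=9$. Then: 1. For each non-zero $u\in W$, $\mathcal M_u$ is a constant rank $3$ subspace of dimension $3$, and its non-zero elements all have the same radical. 2. As $u$ ranges over the non-zero elements of $W$, the set of radicals so obtained is a spread of three-dimensional subspaces of $W$, that is, a set of three-dimensional subspaces, any two different ones of which intersect trivially, and whose union is $W$. 3. Every constant rank $3$ subspace of $\mathcal M$ is contained in $\mathcal M_u$ for some non-zero $u\in W$, and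 the maximal constant rank $3$ subspaces of $\mathcal M$ are precisely the subspaces $\mathcal M_u$ with $u\in W$ non-zero. 4. Let $u,w\in W$ be non-zero with $\mathcal M_u\ne\mathcal M_w$. Then $\mathcal M_u\cap\mathcal M_w=0$, and the six-dimensional subspace $\mathcal M_u\oplus\mathcal M_w$ contains no elements of rank $3$ other than elements of $\mathcal M_u$ and of $\mathcal M_w$. Moreover, if $\mathcal N$ is any three-dimensional constant rank $3$ subspace of $\mathcal M$ different from $\mathcal M_u$ and $\mathcal M_w$, then $(\mathcal M_u\oplus\mathcal M_w)\cap\mathcal N=0$ and $\mathcal M=\mathcal M_u\oplus\mathcal M_w\oplus\mathcal N$. -/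

import Mathlib

namespace SymmForms

variable {K W : Type*} [Field K] [AddCommGroup W] [Module K W]

/-- The space of symmetric bilinear forms on `W`. -/
def symm (K W : Type*) [Field K] [AddCommGroup W] [Module K W] :
    Submodule K (LinearMap.BilinForm K W) where
  carrier := {f | ∀ x y, f x y = f y x}
  zero_mem' := by intro x y; simp
  add_mem' := by
    intro f g hf hg x y
    simp only [LinearMap.add_apply]
    rw [hf x y, hg x y]
  smul_mem' := by
    intro c f hf x y
    simp only [LinearMap.smul_apply]
    rw [hf x y]

/-- The left radical of a bilinear form; for a symmetric form it is also the right radical, and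
it is called the radical. -/
def rad (f : LinearMap.BilinForm K W) : Submodule K W where
  carrier := {u | ∀ v, f u v = 0}
  zero_mem' := by intro v; simp
  add_mem' := by
    intro a b ha hb v
    simp only [map_add, LinearMap.add_apply]
    rw [ha v, hb v, add_zero]
  smul_mem' := by
    intro c a ha v
    simp only [map_smul, LinearMap.smul_apply]
    rw [ha v, smul_zero]

/-- The rank `dim W - dim rad f` of a bilinear form on a finite-dimensional space (the subtraction
does not truncate, as `rad f` is a subspace of `W`). -/
noncomputable def rank (f : LinearMap.BilinForm K W) : ℕ :=
  Module.finrank K W - Module.finrank K (rad f)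

/-- The subspace `M_u` of all the forms in `M` whose radical contains `u`. -/
def radSub (M : Submodule K (LinearMap.BilinForm K W)) (u : W) :
    Submodule K (LinearMap.BilinForm K W) where
  carrier := {f | f ∈ M ∧ u ∈ rad f}
  zero_mem' := ⟨M.zero_mem, fun _ => rfl⟩
  add_mem' := by
    rintro f g ⟨hf, hfu⟩ ⟨hg, hgu⟩
    refine ⟨M.add_mem hf hg, fun v => ?_⟩
    simp only [LinearMap.add_apply]
    rw [hfu v, hgu v, add_zero]
  smul_mem' := by
    rintro c f ⟨hf, hfu⟩
    refine ⟨M.smul_mem c hf, fun v => ?_⟩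
    simp only [LinearMap.smul_apply]
    rw [hfu v, smul_zero]

/-- A constant rank `r` subspace: a non-zero subspace all of whose non-zero elements have
rank `r`. -/
def IsConstantRank (r : ℕ) (N : Submodule K (LinearMap.BilinForm K W)) : Prop :=
  N ≠ ⊥ ∧ ∀ f ∈ N, f ≠ 0 → rank f = r

/-- A spread of `d`-dimensional subspaces of `W`: a set of `d`-dimensional subspaces that pairwise
intersect trivially and that cover `W`. -/
def IsSpread (d : ℕ) (S : Set (Submodule K W)) : Prop :=
  (∀ U ∈ S, Module.finrank K U = d) ∧
  (∀ U ∈ S, ∀ U' ∈ S, U ≠ U' → U ⊓ U' = ⊥) ∧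
  ∀ x : W, ∃ U ∈ S, x ∈ U

end SymmForms

/-! Evaluation at a non-zero `u` maps `M` to the dual of `W`, of dimension 6, with kernel `radSub M
u`. Non-zero forms in this kernel are degenerate, hence of rank 3, so everything rests on constant
rank 3 subspaces having a common radical (`rad_le_rad_of_pencil`). Evaluation at a vector outside
that radical is then injective into its 3-dimensional annihilator, which gives the bound 3 + 6 = 9.

For the common radical, the 4 × 4 minors of `t • f + g` are cubics in `t`, and four scalars suffice
to kill their coefficients. If `u ∈ rad f` and `g u ≠ 0`, this makes `g u = f x` with `g u x = 0`.
On the hyperplane `g u = 0` the form `f` has rank one and the pencil has rank at most one, so some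
member vanishes there. That member is non-zero of rank at most 2, a contradiction.

If `dim M = 9`, every `radSub M u` has dimension 3. Two of them sharing a radical vector coincide,
which yields the spread; radicals of different ones are complementary, so sums of non-zero elements
are nondegenerate. -/

namespace SymmForms

open Module

/-! ### Dimension counts -/

section
variable {K V : Type*} [Field K] [AddCommMonoid V] [Module K V] [Module.Finite K V]

lemma finrank_sup_add_finrank_inf (S T : Submodule K V) :
    finrank K ↥(S ⊔ T) + finrank K ↥(S ⊓ T) = finrank K S + finrank K T := by
  let _ : AddCommGroup V := Module.addCommMonoidToAddCommGroup K
  exact Submodule.finrank_sup_add_finrank_inf_eq S T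

lemma eq_of_le_of_finrank_eq {S T : Submodule K V} (h : S ≤ T) (hd : finrank K S = finrank K T) :
    S = T := by
  let _ : AddCommGroup V := Module.addCommMonoidToAddCommGroup K
  exact Submodule.eq_of_le_of_finrank_eq h hd

lemma finrank_le_finrank_inf_ker_add {E : Type*} [AddCommMonoid E] [Module K E]
    [Module.Finite K E] (φ : V →ₗ[K] E) {M : Submodule K V} {S : Submodule K E}
    (h : ∀ x ∈ M, φ x ∈ S) :
    finrank K M ≤ finrank K ↥(M ⊓ LinearMap.ker φ) + finrank K S := by
  let _ : AddCommGroup V := Module.addCommMonoidToAddCommGroup K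
  let _ : AddCommGroup E := Module.addCommMonoidToAddCommGroup K
  have h1 := LinearMap.finrank_range_add_finrank_ker (φ.domRestrict M)
  have h2 : LinearMap.range (φ.domRestrict M) ≤ S := by
    rintro _ ⟨x, rfl⟩
    exact h x x.2
  have h3 := Submodule.finrank_mono h2
  have h4 : finrank K (LinearMap.ker (φ.domRestrict M)) ≤ finrank K ↥(M ⊓ LinearMap.ker φ) := by
    rw [← Submodule.finrank_map_subtype_eq M (LinearMap.ker (φ.domRestrict M))]
    refine Submodule.finrank_mono ?_
    rintro _ ⟨x, hx, rfl⟩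
    exact ⟨x.2, hx⟩
  omega

end

/-! ### Cubics and determinants of pencils -/

lemma cubic_coeffs_eq_zero {K : Type*} [Field K] (hK : 4 ≤ ENat.card K) {a b c d : K}
    (h : ∀ t : K, a * t ^ 3 + b * t ^ 2 + c * t + d = 0) : a = 0 ∧ b = 0 := by
  obtain ⟨s, -, hs⟩ := Set.exists_subset_encard_eq (s := (Set.univ : Set K)) (k := 4)
    (by simpa [Set.encard_univ] using hK)
  have hfin : s.Finite := Set.finite_of_encard_eq_coe (k := 4) (by simpa using hs)
  have hcard : hfin.toFinset.card = 4 := by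
    have := hfin.encard_eq_coe_toFinset_card
    rw [hs] at this
    exact_mod_cast this.symm
  let p : Polynomial K := Polynomial.C a * Polynomial.X ^ 3 + Polynomial.C b * Polynomial.X ^ 2 +
    Polynomial.C c * Polynomial.X + Polynomial.C d
  have hp : p = 0 := by
    apply Polynomial.eq_zero_of_natDegree_lt_card_of_eval_eq_zero' p hfin.toFinset
    · intro t _
      simpa [p] using h t
    · rw [hcard]
      exact lt_of_le_of_lt Polynomial.natDegree_cubic_le (by norm_num)
  constructor
  · have : p.coeff 3 = 0 := by rw [hp]; simp
    simpa [p, Polynomial.coeff_X, Polynomial.coeff_C] using this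
  · have : p.coeff 2 = 0 := by rw [hp]; simp
    simpa [p, Polynomial.coeff_X, Polynomial.coeff_C] using this

lemma det_fin_four {R : Type*} [CommRing R] (A : Matrix (Fin 4) (Fin 4) R) :
    A.det =
      A 0 0 * (A 1 1 * (A 2 2 * A 3 3 - A 2 3 * A 3 2) -
        A 1 2 * (A 2 1 * A 3 3 - A 2 3 * A 3 1) +
        A 1 3 * (A 2 1 * A 3 2 - A 2 2 * A 3 1)) -
      A 0 1 * (A 1 0 * (A 2 2 * A 3 3 - A 2 3 * A 3 2) -
        A 1 2 * (A 2 0 * A 3 3 - A 2 3 * A 3 0) +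
        A 1 3 * (A 2 0 * A 3 2 - A 2 2 * A 3 0)) +
      A 0 2 * (A 1 0 * (A 2 1 * A 3 3 - A 2 3 * A 3 1) -
        A 1 1 * (A 2 0 * A 3 3 - A 2 3 * A 3 0) +
        A 1 3 * (A 2 0 * A 3 1 - A 2 1 * A 3 0)) -
      A 0 3 * (A 1 0 * (A 2 1 * A 3 2 - A 2 2 * A 3 1) -
        A 1 1 * (A 2 0 * A 3 2 - A 2 2 * A 3 0) +
        A 1 2 * (A 2 0 * A 3 1 - A 2 1 * A 3 0)) := by
  rw [Matrix.det_succ_row_zero]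
  simp only [Fin.sum_univ_four, Matrix.det_fin_three, Matrix.submatrix_apply]
  simp [Fin.succAbove, Fin.lt_def]
  ring

/-- The determinant has `t ^ 3` coefficient `G 3 3`; once this vanishes, the `t ^ 2` coefficient is
minus the second expression. -/
lemma cubic_coeffs_of_det_pencil {K : Type*} [Field K] (hK : 4 ≤ ENat.card K)
    (G : Matrix (Fin 4) (Fin 4) K)
    (h : ∀ t : K, (t • Matrix.diagonal ![1, 1, 1, 0] + G).det = 0) :
    G 3 3 = 0 ∧ G 3 0 * G 0 3 + G 3 1 * G 1 3 + G 3 2 * G 2 3 = 0 := by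
  have key := cubic_coeffs_eq_zero hK (a := G 3 3)
    (b := (G 0 0 + G 1 1 + G 2 2) * G 3 3 - (G 3 0 * G 0 3 + G 3 1 * G 1 3 + G 3 2 * G 2 3))
    (c := (G.submatrix ![0, 1, 3] ![0, 1, 3]).det + (G.submatrix ![0, 2, 3] ![0, 2, 3]).det +
      (G.submatrix ![1, 2, 3] ![1, 2, 3]).det) (d := G.det) (fun t => by
        rw [← h t, Matrix.det_fin_three, Matrix.det_fin_three, Matrix.det_fin_three]
        simp [det_fin_four, Matrix.diagonal]
        ring)
  obtain ⟨h1, h2⟩ := key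
  refine ⟨h1, ?_⟩
  rw [h1, mul_zero, zero_sub, neg_eq_zero] at h2
  exact h2

variable {K W : Type*} [Field K] [AddCommGroup W] [Module K W]

/-! ### Radical, rank and minors -/

lemma mem_rad {f : LinearMap.BilinForm K W} {u : W} : u ∈ rad f ↔ ∀ v, f u v = 0 := Iff.rfl

lemma mem_rad_iff_apply_eq_zero {f : LinearMap.BilinForm K W} {u : W} : u ∈ rad f ↔ f u = 0 :=
  ⟨fun h => LinearMap.ext h, fun h v => by rw [h]; rfl⟩

lemma mem_radSub {M : Submodule K (LinearMap.BilinForm K W)} {u : W} {f : LinearMap.BilinForm K W} :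
    f ∈ radSub M u ↔ f ∈ M ∧ u ∈ rad f := Iff.rfl

lemma rad_eq_ker (f : LinearMap.BilinForm K W) : rad f = LinearMap.ker f := by
  ext u
  rw [mem_rad_iff_apply_eq_zero, LinearMap.mem_ker]

lemma rank_eq_finrank_range [FiniteDimensional K W] (f : LinearMap.BilinForm K W) :
    rank f = finrank K (LinearMap.range f) := by
  have := LinearMap.finrank_range_add_finrank_ker f
  rw [← rad_eq_ker] at this
  unfold rank
  omega

lemma finrank_rad_add_rank [FiniteDimensional K W] (f : LinearMap.BilinForm K W) :
    finrank K (rad f) + rank f = finrank K W :=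
  Nat.add_sub_of_le (Submodule.finrank_le _)

lemma minor_eq_zero [FiniteDimensional K W] {f : LinearMap.BilinForm K W} (hf : rank f ≤ 3)
    (p q : Fin 4 → W) : (Matrix.of fun i j => f (p i) (q j)).det = 0 := by
  rw [rank_eq_finrank_range] at hf
  let L : (Fin 4 → K) →ₗ[K] W →ₗ[K] K := f ∘ₗ Fintype.linearCombination K p
  have h4 := finrank_le_finrank_inf_ker_add L (M := ⊤) (S := LinearMap.range f)
    fun c _ => LinearMap.mem_range_self f _
  rw [finrank_top, finrank_fin_fun, top_inf_eq] at h4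
  obtain ⟨c, hc, hc0⟩ : ∃ c ∈ LinearMap.ker L, c ≠ 0 := by
    refine Submodule.exists_mem_ne_zero_of_ne_bot fun h => ?_
    rw [h, finrank_bot] at h4
    omega
  rw [← Matrix.exists_vecMul_eq_zero_iff]
  refine ⟨c, hc0, ?_⟩
  ext j
  have h1 : f (∑ i, c i • p i) = 0 := hc
  have h2 := LinearMap.congr_fun h1 (q j)
  simpa [Matrix.vecMul, dotProduct] using h2

/-- Restrict `f` to a complement of its radical and take a basis with its dual basis. Unlike an
orthogonal basis, this is available in characteristic 2. -/
lemma exists_dual_families [FiniteDimensional K W] {f : LinearMap.BilinForm K W} (hf : f ∈ symm K W)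
    (hr : rank f = 3) : ∃ e e' : Fin 3 → W, (∀ i j, f (e i) (e' j) = if i = j then 1 else 0) ∧
      Submodule.span K (Set.range e') ⊔ rad f = ⊤ := by
  obtain ⟨C, hC⟩ := Submodule.exists_isCompl (rad f)
  have hdim : finrank K C = 3 := by
    have := Submodule.finrank_add_eq_of_isCompl hC
    have := finrank_rad_add_rank f
    omega
  have hzero : ∀ x : C, (∀ y : C, f x y = 0) → x = 0 := fun x hx => by
    have hxr : (x : W) ∈ rad f := fun v => by
      obtain ⟨r, hr, c, hc, rfl⟩ := Submodule.mem_sup.1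
        (hC.sup_eq_top ▸ Submodule.mem_top : v ∈ rad f ⊔ C)
      rw [map_add, hf _ r, hr, zero_add]
      exact hx ⟨c, hc⟩
    exact Subtype.ext (Submodule.disjoint_def.1 hC.disjoint _ hxr x.2)
  let B : LinearMap.BilinForm K C := LinearMap.BilinForm.restrict f C
  have hB : B.Nondegenerate :=
    ⟨fun x hx => hzero x hx, fun x hx => hzero x fun y => (hf _ _).trans (hx y)⟩
  let b : Basis (Fin 3) K C := finBasisOfFinrankEq K C hdim
  refine ⟨fun i => B.dualBasis hB b i, fun i => b i, fun i j => ?_, ?_⟩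
  · have := LinearMap.BilinForm.apply_dualBasis_left (B := B) hB b i j
    simp only [eq_comm (a := i)]
    exact this
  · have : Submodule.span K (Set.range fun i => (b i : W)) = C := by
      have h := congrArg (Submodule.map C.subtype) b.span_eq
      rw [Submodule.map_span, Submodule.map_top, Submodule.range_subtype, ← Set.range_comp] at h
      exact h
    rw [this, sup_comm]
    exact hC.sup_eq_top

/-! ### Pencils of rank 3 forms -/

/-- In a pencil `t f + g` of forms of rank at most three with `f` of rank three, the radical of `f`
is totally isotropic for `g`, and the functionals `g u` with `u` in it are isotropic for the
inverse of `f`. -/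
lemma exists_apply_eq_of_pencil [FiniteDimensional K W] (hK : 4 ≤ ENat.card K)
    {f g : LinearMap.BilinForm K W} (hf : f ∈ symm K W) (hg : g ∈ symm K W) (hr : rank f = 3)
    (hfg : ∀ t : K, rank (t • f + g) ≤ 3) {u : W} (hu : u ∈ rad f) :
    (∀ v ∈ rad f, g u v = 0) ∧ ∃ x, f x = g u ∧ g u x = 0 := by
  obtain ⟨e, e', he, hspan⟩ := exists_dual_families hf hr
  have hR : ∀ v ∈ rad f, ∀ w, f w v = 0 := fun v hv w => (hf _ _).trans (hv w)
  have key : ∀ v ∈ rad f, g u v = 0 ∧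
      g u (e' 0) * g (e 0) v + g u (e' 1) * g (e 1) v + g u (e' 2) * g (e 2) v = 0 := by
    intro v hv
    let G : Matrix (Fin 4) (Fin 4) K :=
      Matrix.of fun i j => g (![e 0, e 1, e 2, u] i) (![e' 0, e' 1, e' 2, v] j)
    have hdet : ∀ t : K, (t • Matrix.diagonal ![1, 1, 1, 0] + G).det = 0 := fun t => by
      refine (congrArg Matrix.det (Matrix.ext fun i j => ?_)).trans
        (minor_eq_zero (hfg t) ![e 0, e 1, e 2, u] ![e' 0, e' 1, e' 2, v])
      fin_cases i <;> fin_cases j <;>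
        simp [G, he, hR v hv, mem_rad.1 hu]
    exact cubic_coeffs_of_det_pencil hK G hdet
  -- `x` is the vector representing `g u` through `f`: the coefficients are read off on `e'`, and
  -- both functionals vanish on `rad f`.
  refine ⟨fun v hv => (key v hv).1, ∑ i, g u (e' i) • e i, ?_, ?_⟩
  · have hle : Submodule.span K (Set.range e') ⊔ rad f ≤
        LinearMap.ker (f (∑ i, g u (e' i) • e i) - g u) := by
      refine sup_le (Submodule.span_le.2 ?_) fun v hv => ?_
      · rintro _ ⟨j, rfl⟩
        simp [he]
      · simp [hR v hv, (key v hv).1]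
    rw [hspan, top_le_iff, LinearMap.ker_eq_top, sub_eq_zero] at hle
    exact hle
  · have := (key u hu).2
    rw [hg (e 0), hg (e 1), hg (e 2)] at this
    rw [Fin.sum_univ_three, map_add, map_add, map_smul, map_smul, map_smul]
    exact this

/-- The radical contains the common kernel of `α` and `g e`, of codimension at most 2. -/
lemma rank_le_two_of_isotropic_ker [FiniteDimensional K W] {g : LinearMap.BilinForm K W}
    (hg : g ∈ symm K W) {α : W →ₗ[K] K} {e : W} (he : α e = 1)
    (h : ∀ y z, α y = 0 → α z = 0 → g y z = 0) : rank g ≤ 2 := by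
  have hle : LinearMap.ker (α.prod (g e)) ≤ rad g := by
    intro y hy v
    replace hy : α y = 0 ∧ g e y = 0 := Prod.mk_eq_zero.1 hy
    have h1 : g y (v - α v • e) = 0 := h _ _ hy.1 (by simp [he])
    rw [map_sub, map_smul, hg y e, hy.2, smul_zero, sub_zero] at h1
    exact h1
  have h1 := Submodule.finrank_mono hle
  have h2 := LinearMap.finrank_range_add_finrank_ker (α.prod (g e))
  have h3 : finrank K (LinearMap.range (α.prod (g e))) ≤ 2 := by
    refine (Submodule.finrank_le _).trans ?_
    simp
  have h4 := finrank_rad_add_rank g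
  omega

/-- A form of rank at most three whose value at `u` is `α`, where `α u = 0`, has rank at most one
on the kernel of `α`. -/
lemma minor_on_ker_eq_zero [FiniteDimensional K W] {g : LinearMap.BilinForm K W} (hg : g ∈ symm K W)
    (hr : rank g ≤ 3) {u e y z z' : W} (he : g u e = 1) (hu : g u u = 0) (hy : g u y = 0)
    (hz : g u z = 0) (hz' : g u z' = 0) : g y y * g z z' = g y z' * g z y := by
  -- The row and the column of `u` have a single non-zero entry, at `e`, so this minor is minus the
  -- 2 × 2 minor on `y, z` and `y, z'`.
  have h := minor_eq_zero hr ![u, e, y, z] ![u, e, y, z']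
  have he' : g e u = 1 := (hg _ _).trans he
  have hy' : g y u = 0 := (hg _ _).trans hy
  have hz0 : g z u = 0 := (hg _ _).trans hz
  simp [det_fin_four, he, hu, hy, hz', he', hy', hz0] at h
  linear_combination -h

/-- If `f` has rank three and `f x` is a non-zero functional vanishing at `x`, then `f` has rank one
on the kernel of that functional. -/
lemma exists_decomposition [FiniteDimensional K W] {f : LinearMap.BilinForm K W}
    (hf : f ∈ symm K W) (hr : rank f = 3) {x e : W} (he : f x e = 1) (hx : f x x = 0) :
    ∃ y, f x y = 0 ∧ f y y ≠ 0 ∧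
      ∀ z, f x z = 0 → ∃ c : K, ∀ v, f x v = 0 → f (z - c • y) v = 0 := by
  have hxR : x ∉ rad f := fun h => by simp [mem_rad.1 h e] at he
  have hx0 : x ≠ 0 := fun h => hxR (h ▸ (rad f).zero_mem)
  -- `rad f ⊔ K ∙ x` pairs to zero with the hyperplane `ker (f x)` and has codimension one in it, so
  -- any `y` in the hyperplane outside it will do.
  have hS : finrank K ↥(rad f ⊔ K ∙ x) = finrank K (rad f) + 1 := by
    have h := Submodule.finrank_sup_add_finrank_inf_eq (rad f) (K ∙ x)
    rw [((Submodule.disjoint_span_singleton' hx0).2 hxR).eq_bot, finrank_bot,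
      finrank_span_singleton hx0] at h
    exact h
  have hSf : ∀ s ∈ rad f ⊔ K ∙ x, ∀ v, f x v = 0 → f s v = 0 := by
    intro s hs v hv
    obtain ⟨r, hr, w, hw, rfl⟩ := Submodule.mem_sup.1 hs
    obtain ⟨a, rfl⟩ := Submodule.mem_span_singleton.1 hw
    simp [mem_rad.1 hr v, hv]
  have hSH : rad f ⊔ K ∙ x ≤ LinearMap.ker (f x) := fun s hs => by
    rw [LinearMap.mem_ker, hf]
    exact hSf s hs x hx
  have hH : finrank K (LinearMap.ker (f x)) + 1 = finrank K W := by
    have h := LinearMap.finrank_range_add_finrank_ker (f x)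
    have hsurj : Function.Surjective (f x) := LinearMap.surjective fun h => by simp [h] at he
    rw [LinearMap.range_eq_top.2 hsurj, finrank_top, finrank_self] at h
    omega
  have hW := finrank_rad_add_rank f
  obtain ⟨y, hy, hyS⟩ : ∃ y ∈ LinearMap.ker (f x), y ∉ rad f ⊔ K ∙ x := by
    by_contra! hcon
    have := Submodule.finrank_mono (show LinearMap.ker (f x) ≤ rad f ⊔ K ∙ x from hcon)
    omega
  have hy0 : y ≠ 0 := fun h => hyS (h ▸ Submodule.zero_mem _)
  have hsup : rad f ⊔ K ∙ x ⊔ K ∙ y = LinearMap.ker (f x) := by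
    refine Submodule.eq_of_le_of_finrank_eq
      (sup_le hSH ((Submodule.span_singleton_le_iff_mem _ _).2 hy)) ?_
    have h := Submodule.finrank_sup_add_finrank_inf_eq (rad f ⊔ K ∙ x) (K ∙ y)
    rw [((Submodule.disjoint_span_singleton' hy0).2 hyS).eq_bot, finrank_bot,
      finrank_span_singleton hy0] at h
    omega
  have hdec : ∀ z, f x z = 0 → ∃ c : K, ∀ v, f x v = 0 → f (z - c • y) v = 0 := by
    intro z hz
    obtain ⟨s, hs, w, hw, rfl⟩ := Submodule.mem_sup.1 (hsup ▸ hz : z ∈ rad f ⊔ K ∙ x ⊔ K ∙ y)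
    obtain ⟨c, rfl⟩ := Submodule.mem_span_singleton.1 hw
    exact ⟨c, fun v hv => by rw [add_sub_cancel_right]; exact hSf s hs v hv⟩
  refine ⟨y, hy, fun hyy => ?_, hdec⟩
  have hyH : ∀ z, f x z = 0 → f z y = 0 := fun z hz => by
    obtain ⟨c, hc⟩ := hdec z hz
    have h := hc y hy
    simpa [hyy] using h
  have := rank_le_two_of_isotropic_ker hf he fun z v hz hv => by
    obtain ⟨c, hc⟩ := hdec z hz
    have h := hc v hv
    simpa [hf y v, hyH v hv] using h
  omega

/-- If `f` has rank three and every non-zero form `t f + g` has rank three, then the radical of `f`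
is contained in that of `g`. -/
theorem rad_le_rad_of_pencil (hK : 4 ≤ ENat.card K) [FiniteDimensional K W]
    {f g : LinearMap.BilinForm K W} (hf : f ∈ symm K W) (hg : g ∈ symm K W) (hr : rank f = 3)
    (hfg : ∀ t : K, t • f + g ≠ 0 → rank (t • f + g) = 3) : rad f ≤ rad g := by
  have hle : ∀ t : K, rank (t • f + g) ≤ 3 := fun t => by
    by_cases h0 : t • f + g = 0
    · rw [h0, rank_eq_finrank_range, LinearMap.range_zero, finrank_bot]
      omega
    · exact (hfg t h0).le
  intro u hu
  by_contra hgu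
  rw [mem_rad_iff_apply_eq_zero] at hgu
  obtain ⟨hiso, x, hx, hgx⟩ := exists_apply_eq_of_pencil hK hf hg hr hle hu
  obtain ⟨e, he⟩ : ∃ e, g u e = 1 := by
    obtain ⟨e, he⟩ := DFunLike.ne_iff.1 hgu
    exact ⟨(g u e)⁻¹ • e, by simpa using inv_mul_cancel₀ he⟩
  have hfu : ∀ v, f u v = 0 := hu
  obtain ⟨y, hy, hyy, hdec⟩ := exists_decomposition hf hr (by rw [hx, he] : f x e = 1)
    (by rw [hx, hgx])
  rw [hx] at hy hdec
  -- The member of the pencil for which `y` is isotropic; it will vanish on the whole hyperplane.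
  set t : K := -(g y y / f y y) with ht
  have hg' : t • f + g ∈ symm K W := add_mem (Submodule.smul_mem _ _ hf) hg
  have hgu' : ∀ s : K, ∀ v, (s • f + g) u v = g u v := fun s v => by simp [hfu]
  have hminor : ∀ s : K, ∀ z z', g u z = 0 → g u z' = 0 →
      (s • f + g) y y * (s • f + g) z z' = (s • f + g) y z' * (s • f + g) z y :=
    fun s z z' hz hz' => minor_on_ker_eq_zero (add_mem (Submodule.smul_mem _ _ hf) hg) (hle s)
      (u := u) (e := e) (by rw [hgu', he]) (by rw [hgu', hiso u hu]) (by rw [hgu', hy])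
      (by rw [hgu', hz]) (by rw [hgu', hz'])
  have hgyy : (t • f + g) y y = 0 := by
    simp [ht, hyy]
  have hyz : ∀ z, g u z = 0 → (t • f + g) y z = 0 := fun z hz => by
    have h := hminor t z z hz hz
    rw [hgyy, zero_mul, hg' z y] at h
    exact mul_self_eq_zero.1 h.symm
  have hzz : ∀ z z', g u z = 0 → g u z' = 0 → (t • f + g) z z' = 0 := fun z z' hz hz' => by
    obtain ⟨c, hc⟩ := hdec z hz
    have hz1 : g u (z - c • y) = 0 := by simp [hz, hy]
    -- Moving on to `t + 1` makes the value at `(y, y)` equal to `f y y ≠ 0`, while `f` does not see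
    -- `z - c • y` on the hyperplane.
    have h := hminor (t + 1) (z - c • y) z' hz1 hz'
    have hsplit : ∀ v w, ((t + 1) • f + g) v w = f v w + (t • f + g) v w := fun v w => by
      simp only [LinearMap.add_apply, LinearMap.smul_apply, smul_eq_mul]; ring
    rw [hsplit y y, hsplit (z - c • y) z', hsplit (z - c • y) y, hc z' hz', hc y hy, hgyy,
      hg' (z - c • y) y, hyz _ hz1, zero_add, add_zero, add_zero, mul_zero] at h
    have h2 := (mul_eq_zero.1 h).resolve_left hyy
    rwa [map_sub, map_smul, LinearMap.sub_apply, LinearMap.smul_apply, hyz z' hz', smul_zero,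
      sub_zero] at h2
  have hrank := rank_le_two_of_isotropic_ker hg' he hzz
  have hne : t • f + g ≠ 0 := fun h0 => by
    have := hgu' t e
    rw [h0, he] at this
    simp at this
  have := hfg t hne
  omega

/-! ### Constant rank 3 subspaces -/

theorem rad_eq_rad_of_constantRank (hK : 4 ≤ ENat.card K) [FiniteDimensional K W]
    {N : Submodule K (LinearMap.BilinForm K W)} (hN : N ≤ symm K W)
    (hr : ∀ f ∈ N, f ≠ 0 → rank f = 3) {f g : LinearMap.BilinForm K W} (hf : f ∈ N) (hg : g ∈ N)
    (hf0 : f ≠ 0) (hg0 : g ≠ 0) : rad f = rad g :=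
  le_antisymm
    (rad_le_rad_of_pencil hK (hN hf) (hN hg) (hr f hf hf0)
      fun t => hr _ (N.add_mem (N.smul_mem t hf) hg))
    (rad_le_rad_of_pencil hK (hN hg) (hN hf) (hr g hg hg0)
      fun t => hr _ (N.add_mem (N.smul_mem t hg) hf))

theorem finrank_le_three_of_constantRank (hK : 4 ≤ ENat.card K) [FiniteDimensional K W]
    {N : Submodule K (LinearMap.BilinForm K W)} (hN : N ≤ symm K W)
    (hr : ∀ f ∈ N, f ≠ 0 → rank f = 3) : finrank K N ≤ 3 := by
  by_cases hbot : N = ⊥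
  · rw [hbot, finrank_bot]
    omega
  obtain ⟨f, hf, hf0⟩ := Submodule.exists_mem_ne_zero_of_ne_bot hbot
  have hdim := finrank_rad_add_rank f
  rw [hr f hf hf0] at hdim
  have hlt : rad f < ⊤ := lt_top_iff_ne_top.2 fun h => by
    rw [h, finrank_top] at hdim
    omega
  obtain ⟨w, -, hw⟩ := SetLike.exists_of_lt hlt
  -- A non-zero form killed by evaluation at `w` would have `w` in the common radical.
  have hker : N ⊓ LinearMap.ker (LinearMap.applyₗ w : LinearMap.BilinForm K W →ₗ[K] _) = ⊥ := by
    rw [eq_bot_iff]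
    rintro g ⟨hg, hgw⟩
    by_contra hg0
    refine hw ?_
    rw [rad_eq_rad_of_constantRank hK hN hr hf hg hf0 hg0]
    exact mem_rad_iff_apply_eq_zero.2 hgw
  have h1 := finrank_le_finrank_inf_ker_add
    (LinearMap.applyₗ w : LinearMap.BilinForm K W →ₗ[K] W →ₗ[K] K)
    (M := N) (S := (rad f).dualAnnihilator) fun g hg => by
      rw [Submodule.mem_dualAnnihilator]
      intro v hv
      change g w v = 0
      rw [hN hg]
      by_cases hg0 : g = 0
      · rw [hg0]; rfl
      · rw [rad_eq_rad_of_constantRank hK hN hr hf hg hf0 hg0] at hv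
        exact hv w
  rw [hker, finrank_bot] at h1
  have h2 : finrank K (rad f) + finrank K (rad f).dualAnnihilator = finrank K W :=
    Subspace.finrank_add_finrank_dualAnnihilator_eq (rad f)
  have h3 : finrank K (rad f).dualAnnihilator = 3 := by omega
  exact h1.trans_eq ((zero_add _).trans h3)

/-! ### The subspaces `radSub M u` -/

lemma finrank_le_finrank_radSub_add [FiniteDimensional K W]
    (M : Submodule K (LinearMap.BilinForm K W)) (u : W) :
    finrank K M ≤ finrank K (radSub M u) + finrank K W := by
  have h := finrank_le_finrank_inf_ker_add
    (LinearMap.applyₗ u : LinearMap.BilinForm K W →ₗ[K] W →ₗ[K] K)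
    (M := M) (S := ⊤) fun _ _ => Submodule.mem_top
  have h1 : M ⊓ LinearMap.ker (LinearMap.applyₗ u : LinearMap.BilinForm K W →ₗ[K] _) =
      radSub M u := by
    ext f
    rw [mem_radSub, mem_rad_iff_apply_eq_zero]
    rfl
  rw [h1, finrank_top] at h
  exact h.trans_eq (congrArg _ Subspace.dual_finrank_eq)

lemma rank_eq_three_of_mem_radSub [FiniteDimensional K W] (hW : finrank K W = 6)
    {M : Submodule K (LinearMap.BilinForm K W)}
    (hrank : ∀ f ∈ M, f ≠ 0 → rank f = 3 ∨ rank f = 6) {u : W} (hu : u ≠ 0)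
    {f : LinearMap.BilinForm K W} (hf : f ∈ radSub M u) (hf0 : f ≠ 0) : rank f = 3 := by
  refine (hrank f hf.1 hf0).resolve_right fun h => hu ?_
  have hdim := finrank_rad_add_rank f
  have h0 : rad f = ⊥ := Submodule.finrank_eq_zero.1 (by omega)
  have := hf.2
  rwa [h0, Submodule.mem_bot] at this

lemma rad_ne_bot_of_rank_eq_three [FiniteDimensional K W] (hW : finrank K W = 6)
    {f : LinearMap.BilinForm K W} (hf : rank f = 3) : rad f ≠ ⊥ := fun h => by
  have hdim := finrank_rad_add_rank f
  rw [h, finrank_bot] at hdim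
  omega

theorem finrank_radSub_le_three (hK : 4 ≤ ENat.card K) [FiniteDimensional K W]
    (hW : finrank K W = 6) {M : Submodule K (LinearMap.BilinForm K W)} (hM : M ≤ symm K W)
    (hrank : ∀ f ∈ M, f ≠ 0 → rank f = 3 ∨ rank f = 6) {u : W} (hu : u ≠ 0) :
    finrank K (radSub M u) ≤ 3 :=
  finrank_le_three_of_constantRank hK (fun _ hf => hM hf.1)
    fun _ hf hf0 => rank_eq_three_of_mem_radSub hW hrank hu hf hf0

/-- A constant rank three subspace is contained in some `radSub M u`. -/
lemma exists_le_radSub (hK : 4 ≤ ENat.card K) [FiniteDimensional K W] (hW : finrank K W = 6)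
    {M N : Submodule K (LinearMap.BilinForm K W)} (hM : M ≤ symm K W) (hNM : N ≤ M)
    (hN : IsConstantRank 3 N) : ∃ u : W, u ≠ 0 ∧ N ≤ radSub M u := by
  obtain ⟨f, hf, hf0⟩ := Submodule.exists_mem_ne_zero_of_ne_bot hN.1
  obtain ⟨u, hu, hu0⟩ := Submodule.exists_mem_ne_zero_of_ne_bot
    (rad_ne_bot_of_rank_eq_three hW (hN.2 f hf hf0))
  refine ⟨u, hu0, fun g hg => ⟨hNM hg, ?_⟩⟩
  by_cases hg0 : g = 0
  · exact hg0 ▸ (fun _ => rfl)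
  · rwa [← rad_eq_rad_of_constantRank hK (hNM.trans hM) hN.2 hf hg hf0 hg0]

/-- If the radicals of `a` and `b` are complementary, then `a + b` is nondegenerate. -/
lemma rad_add_eq_bot {a b : LinearMap.BilinForm K W} (ha : a ∈ symm K W) (hb : b ∈ symm K W)
    (hab : IsCompl (rad a) (rad b)) : rad (a + b) = ⊥ := by
  rw [eq_bot_iff]
  intro v hv
  have hva : v ∈ rad a := fun w => by
    obtain ⟨r, hr, s, hs, rfl⟩ := Submodule.mem_sup.1
      (hab.sup_eq_top ▸ Submodule.mem_top : w ∈ rad a ⊔ rad b)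
    have h := hv s
    rw [LinearMap.add_apply, LinearMap.add_apply, hb v s, hs v, add_zero] at h
    rw [map_add, ha v r, hr v, h, add_zero]
  have hvb : v ∈ rad b := fun w => by
    have h := hv w
    rwa [LinearMap.add_apply, LinearMap.add_apply, hva w, zero_add] at h
  exact Submodule.disjoint_def.1 hab.disjoint v hva hvb

end SymmForms

/-! ### The bound and the case of dimension 9 -/

theorem mainTheorem12 {K W : Type*} [Field K] [AddCommGroup W] [Module K W]
    (hK : 4 ≤ ENat.card K) (hW : Module.finrank K W = 6)
    (M : Submodule K (LinearMap.BilinForm K W)) (hM : M ≤ SymmForms.symm K W)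
    (hrank : ∀ f ∈ M, f ≠ 0 → SymmForms.rank f = 3 ∨ SymmForms.rank f = 6) :
    Module.finrank K M ≤ 9 ∧
    (Module.finrank K M = 9 →
      -- each `M_u` is a 3-dimensional constant rank 3 subspace with a common radical
      (∀ u : W, u ≠ 0 →
        Module.finrank K (SymmForms.radSub M u) = 3 ∧
        SymmForms.IsConstantRank 3 (SymmForms.radSub M u) ∧
        ∀ f ∈ SymmForms.radSub M u, ∀ g ∈ SymmForms.radSub M u, f ≠ 0 → g ≠ 0 →
          SymmForms.rad f = SymmForms.rad g) ∧
      -- the radicals form a spread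
      SymmForms.IsSpread 3 {U : Submodule K W |
        ∃ u : W, u ≠ 0 ∧ ∃ f ∈ SymmForms.radSub M u, f ≠ 0 ∧ SymmForms.rad f = U} ∧
      -- every constant rank 3 subspace of `M` lies in some `M_u`
      (∀ N ≤ M, SymmForms.IsConstantRank 3 N → ∃ u : W, u ≠ 0 ∧ N ≤ SymmForms.radSub M u) ∧
      -- the `M_u` are exactly the maximal constant rank 3 subspaces of `M`
      (∀ N : Submodule K (LinearMap.BilinForm K W),
        Maximal (fun N' => N' ≤ M ∧ SymmForms.IsConstantRank 3 N') N ↔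
          ∃ u : W, u ≠ 0 ∧ N = SymmForms.radSub M u) ∧
      -- direct sums of two and three such subspaces
      (∀ u w : W, u ≠ 0 → w ≠ 0 → SymmForms.radSub M u ≠ SymmForms.radSub M w →
        SymmForms.radSub M u ⊓ SymmForms.radSub M w = ⊥ ∧
        Module.finrank K ↥(SymmForms.radSub M u ⊔ SymmForms.radSub M w) = 6 ∧
        (∀ f ∈ SymmForms.radSub M u ⊔ SymmForms.radSub M w, SymmForms.rank f = 3 →
          f ∈ SymmForms.radSub M u ∨ f ∈ SymmForms.radSub M w) ∧
        ∀ N ≤ M, Module.finrank K N = 3 → SymmForms.IsConstantRank 3 N →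
          N ≠ SymmForms.radSub M u → N ≠ SymmForms.radSub M w →
            (SymmForms.radSub M u ⊔ SymmForms.radSub M w) ⊓ N = ⊥ ∧
            SymmForms.radSub M u ⊔ SymmForms.radSub M w ⊔ N = M)) := by
  have : FiniteDimensional K W := Module.finite_of_finrank_pos (by omega)
  have : Nontrivial W := Module.nontrivial_of_finrank_pos (R := K) (by omega)
  refine ⟨?_, fun h9 => ?_⟩
  · obtain ⟨u, hu⟩ := exists_ne (0 : W)
    have h1 := SymmForms.finrank_le_finrank_radSub_add M u
    have h2 := SymmForms.finrank_radSub_le_three hK hW hM hrank hu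
    omega
  have hdim : ∀ u : W, u ≠ 0 → Module.finrank K (SymmForms.radSub M u) = 3 := fun u hu => by
    have h1 := SymmForms.finrank_le_finrank_radSub_add M u
    have h2 := SymmForms.finrank_radSub_le_three hK hW hM hrank hu
    omega
  have hle : ∀ u : W, SymmForms.radSub M u ≤ M := fun u f hf => hf.1
  have hbot : ∀ u : W, u ≠ 0 → SymmForms.radSub M u ≠ ⊥ := fun u hu h => by
    have := hdim u hu
    rw [h, finrank_bot] at this
    omega
  have hconst : ∀ u : W, u ≠ 0 → SymmForms.IsConstantRank 3 (SymmForms.radSub M u) :=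
    fun u hu => ⟨hbot u hu,
      fun f hf hf0 => SymmForms.rank_eq_three_of_mem_radSub hW hrank hu hf hf0⟩
  have hrad : ∀ u : W, u ≠ 0 → ∀ f ∈ SymmForms.radSub M u, ∀ g ∈ SymmForms.radSub M u,
      f ≠ 0 → g ≠ 0 → SymmForms.rad f = SymmForms.rad g := fun u hu f hf g hg hf0 hg0 =>
    SymmForms.rad_eq_rad_of_constantRank hK ((hle u).trans hM) (hconst u hu).2 hf hg hf0 hg0
  have heq_of_le : ∀ u w : W, u ≠ 0 → w ≠ 0 → SymmForms.radSub M u ≤ SymmForms.radSub M w →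
      SymmForms.radSub M u = SymmForms.radSub M w := fun u w hu hw h =>
    SymmForms.eq_of_le_of_finrank_eq h ((hdim u hu).trans (hdim w hw).symm)
  -- A vector in the radical of one non-zero element of `radSub M u` lies in all of their radicals;
  -- equal dimensions turn the inclusion into equality.
  have heq_of_mem : ∀ u w : W, u ≠ 0 → w ≠ 0 → ∀ f ∈ SymmForms.radSub M u, f ≠ 0 →
      w ∈ SymmForms.rad f → SymmForms.radSub M u = SymmForms.radSub M w := by
    intro u w hu hw f hf hf0 hwf
    refine heq_of_le u w hu hw fun g hg => ⟨hg.1, ?_⟩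
    by_cases hg0 : g = 0
    · exact hg0 ▸ (fun _ => rfl)
    · rwa [← hrad u hu f hf g hg hf0 hg0]
  have hinf : ∀ u w : W, u ≠ 0 → w ≠ 0 → SymmForms.radSub M u ≠ SymmForms.radSub M w →
      SymmForms.radSub M u ⊓ SymmForms.radSub M w = ⊥ := by
    intro u w hu hw hne
    rw [eq_bot_iff]
    rintro f ⟨hfu, hfw⟩
    by_contra hf0
    exact hne (heq_of_mem u w hu hw f hfu hf0 hfw.2)
  have hradinf : ∀ u w : W, u ≠ 0 → w ≠ 0 → SymmForms.radSub M u ≠ SymmForms.radSub M w →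
      ∀ f ∈ SymmForms.radSub M u, ∀ g ∈ SymmForms.radSub M w, f ≠ 0 → g ≠ 0 →
        SymmForms.rad f ⊓ SymmForms.rad g = ⊥ := by
    intro u w hu hw hne f hf g hg hf0 hg0
    rw [eq_bot_iff]
    rintro v ⟨hvf, hvg⟩
    by_contra hv0
    exact hne ((heq_of_mem u v hu hv0 f hf hf0 hvf).trans
      (heq_of_mem w v hw hv0 g hg hg0 hvg).symm)
  have hfin : ∀ f : LinearMap.BilinForm K W, SymmForms.rank f = 3 →
      Module.finrank K (SymmForms.rad f) = 3 := fun f hf => by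
    have := SymmForms.finrank_rad_add_rank f
    omega
  have hexists : ∀ N ≤ M, SymmForms.IsConstantRank 3 N →
      ∃ u : W, u ≠ 0 ∧ N ≤ SymmForms.radSub M u := fun N hNM hN =>
    SymmForms.exists_le_radSub hK hW hM hNM hN
  have hcover : ∀ u : W, u ≠ 0 → ∃ f ∈ SymmForms.radSub M u, f ≠ 0 := fun u hu =>
    Submodule.exists_mem_ne_zero_of_ne_bot (hbot u hu)
  refine ⟨fun u hu => ⟨hdim u hu, hconst u hu, hrad u hu⟩, ⟨?_, ?_, ?_⟩, hexists, ?_, ?_⟩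
  · rintro _ ⟨u, hu, f, hf, hf0, rfl⟩
    exact hfin f ((hconst u hu).2 f hf hf0)
  · rintro _ ⟨u, hu, f, hf, hf0, rfl⟩ _ ⟨w, hw, g, hg, hg0, rfl⟩ hne
    refine hradinf u w hu hw (fun h => hne ?_) f hf g hg hf0 hg0
    exact hrad u hu f hf g (h ▸ hg) hf0 hg0
  · intro x
    by_cases hx : x = 0
    · obtain ⟨u, hu⟩ := exists_ne (0 : W)
      obtain ⟨f, hf, hf0⟩ := hcover u hu
      exact ⟨_, ⟨u, hu, f, hf, hf0, rfl⟩, hx ▸ Submodule.zero_mem _⟩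
    · obtain ⟨f, hf, hf0⟩ := hcover x hx
      exact ⟨_, ⟨x, hx, f, hf, hf0, rfl⟩, hf.2⟩
  · intro N
    constructor
    · rintro ⟨⟨hNM, hN⟩, hmax⟩
      obtain ⟨u, hu, hNu⟩ := hexists N hNM hN
      exact ⟨u, hu, le_antisymm hNu (hmax ⟨hle u, hconst u hu⟩ hNu)⟩
    · rintro ⟨u, hu, rfl⟩
      refine ⟨⟨hle u, hconst u hu⟩, fun N ⟨hNM, hN⟩ hle' => ?_⟩
      obtain ⟨w, hw, hNw⟩ := hexists N hNM hN
      rw [heq_of_le u w hu hw (hle'.trans hNw)]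
      exact hNw
  · intro u w hu hw hne
    have hsum : Module.finrank K ↥(SymmForms.radSub M u ⊔ SymmForms.radSub M w) = 6 := by
      have h := SymmForms.finrank_sup_add_finrank_inf (SymmForms.radSub M u)
        (SymmForms.radSub M w)
      rw [hinf u w hu hw hne, finrank_bot, hdim u hu, hdim w hw] at h
      exact h
    have hthree : ∀ f ∈ SymmForms.radSub M u ⊔ SymmForms.radSub M w, SymmForms.rank f = 3 →
        f ∈ SymmForms.radSub M u ∨ f ∈ SymmForms.radSub M w := by
      intro f hf hf3
      obtain ⟨a, ha, b, hb, rfl⟩ := Submodule.mem_sup.1 hf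
      by_cases ha0 : a = 0
      · right; rwa [ha0, zero_add]
      by_cases hb0 : b = 0
      · left; rwa [hb0, add_zero]
      exfalso
      have hab := hradinf u w hu hw hne a ha b hb ha0 hb0
      have h := SymmForms.finrank_sup_add_finrank_inf (SymmForms.rad a) (SymmForms.rad b)
      rw [hab, finrank_bot, hfin a ((hconst u hu).2 a ha ha0),
        hfin b ((hconst w hw).2 b hb hb0)] at h
      -- Two 3-dimensional radicals meeting trivially fill `W`, so `a + b` has rank 6, not 3.
      have hcompl : IsCompl (SymmForms.rad a) (SymmForms.rad b) :=
        IsCompl.of_eq hab (Submodule.eq_top_of_finrank_eq (by omega))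
      exact SymmForms.rad_ne_bot_of_rank_eq_three hW hf3
        (SymmForms.rad_add_eq_bot (hM ha.1) (hM hb.1) hcompl)
    refine ⟨hinf u w hu hw hne, hsum, hthree, ?_⟩
    intro N hNM hN3 hN hNu hNw
    obtain ⟨v, hv, hNv⟩ := hexists N hNM hN
    obtain rfl : N = SymmForms.radSub M v :=
      SymmForms.eq_of_le_of_finrank_eq hNv (hN3.trans (hdim v hv).symm)
    have hbot3 : (SymmForms.radSub M u ⊔ SymmForms.radSub M w) ⊓ SymmForms.radSub M v = ⊥ := by
      rw [eq_bot_iff]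
      rintro f ⟨hf, hfv⟩
      by_contra hf0
      rcases hthree f hf (hN.2 f hfv hf0) with h | h
      · exact hNu (heq_of_mem v u hv hu f hfv hf0 h.2)
      · exact hNw (heq_of_mem v w hv hw f hfv hf0 h.2)
    refine ⟨hbot3, SymmForms.eq_of_le_of_finrank_eq
      (sup_le (sup_le (hle u) (hle w)) (hle v)) ?_⟩
    have h := SymmForms.finrank_sup_add_finrank_inf
      (SymmForms.radSub M u ⊔ SymmForms.radSub M w) (SymmForms.radSub M v)
    rw [hbot3, finrank_bot, hsum, hdim v hv] at h
    rw [h9]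
    exact h
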